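/- Let $\nu>0$. For $d\ge 1$ let $L^{2,\nu}(\mathbb R^d,\mathbb C)$ be the Hilbert space of functions that are square integrable for $e^{-\nu|x|^2}dx$, and let $\mathcal F^{2,\nu}(\mathbb C^d)$ be the Bargmann–Fock space of holomorphic functions on $\mathbb C^d$ that are square integrable for $e^{-\nu|z|^2}d\lambda(z)$, with the norm of $L^2(\mathbb C^d,e^{-\nu|z|^2}d\lambda)$, where $dx$ and $d\lambda$ are the Lebesgue measures. The $d$-dimensional Segal–Bargmann transform is $$\mathcal B^{d,\nu}f(z)=\Big(\frac{\nu}{\pi}\Big)^{3d/4}\int_{\mathbb R^d}f(x)\,e^{-\nu\left(x-\frac{z}{\sqrt2}\right)^2}dx,\qquad z\in\mathbb C^d,\quad\text{where } v^2:=v_1^2+\dots+v_d^2 .$$ For $f\in L^{2,\nu}(\mathbb R,\mathbb C)$ put $$\mathcal G^\nu f(z,w)=\Big(\frac{\nu}{\pi}\Big)^{1/2}\,\mathcal B^{1,\nu}f\Big(\frac{z+iw}{\sqrt2}\Big),\qquad (z,w)\in\mathbb C^2 .$$ **Theorem.** For every $f\in L^{2,\nu}(\mathbb R,\mathbb C)$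 the integral defining $\mathcal B^{1,\nu}f(\xi)$ converges absolutely for all $\xi\in\mathbb C$, and $\mathcal B^{1,\nu}f\in\mathcal F^{2,\nu}(\mathbb C)$. Regarding $\mathcal B^{1,\nu}f$ as a function on $\mathbb R^2$ through $\xi=x+iy$, the integral defining $\mathcal B^{2,\nu}(\mathcal B^{1,\nu}f)(z,w)$ converges absolutely for all $(z,w)\in\mathbb C^2$, and $$\mathcal G^\nu f=\mathcal B^{2,\nu}\big(\mathcal B^{1,\nu}f\big)\quad\text{on }\mathbb C^2 .$$ Moreover, $\mathcal G^\nu$ is a linear isometry from $L^{2,\nu}(\mathbb R,\mathbb C)$ into $\mathcal F^{2,\nu}(\mathbb C^2)$. -/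

import Mathlib

open MeasureTheory

noncomputable section

/-- The Gaussian measure `exp (-ν |x|²) dx` (not normalised), `dx` being Lebesgue measure. -/
def gaussWeight (E : Type*) [NormedAddCommGroup E] [MeasureSpace E] (ν : ℝ) : Measure E :=
  volume.withDensity fun x => ENNReal.ofReal (Real.exp (-ν * ‖x‖ ^ 2))

/-- The kernel `(ν/π)^(3d/4) exp (-ν (x - z/√2)²)`, where `v² = v₁² + ⋯ + v_d²` on `ℂ^d`
(bilinear, no conjugation). -/
def sbKernel (d : ℕ) (ν : ℝ) (z : EuclideanSpace ℂ (Fin d)) (x : EuclideanSpace ℝ (Fin d)) : ℂ :=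
  (((ν / Real.pi) ^ (3 * (d : ℝ) / 4) : ℝ) : ℂ) *
    Complex.exp (-(ν : ℂ) * ∑ j, ((x j : ℂ) - z j / ((Real.sqrt 2 : ℝ) : ℂ)) ^ 2)

/-- The `d`-dimensional Segal–Bargmann transform. -/
def segalBargmann (d : ℕ) (ν : ℝ) (f : EuclideanSpace ℝ (Fin d) → ℂ)
    (z : EuclideanSpace ℂ (Fin d)) : ℂ :=
  ∫ x, f x * sbKernel d ν z x

/-- A function on `ℝ`, read as a function on `ℝ¹`. -/
def onR1 (f : ℝ → ℂ) (x : EuclideanSpace ℝ (Fin 1)) : ℂ := f (x 0)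

/-- A function on `ℂ`, read as a function on `ℝ²` through `ξ = x + i y`. -/
def onR2 (h : ℂ → ℂ) (x : EuclideanSpace ℝ (Fin 2)) : ℂ :=
  h ((x 0 : ℂ) + Complex.I * (x 1 : ℂ))

/-- The transform `B^{1,ν}`, from functions on `ℝ` to functions on `ℂ`. -/
def segalBargmann1 (ν : ℝ) (f : ℝ → ℂ) (ξ : ℂ) : ℂ :=
  segalBargmann 1 ν (onR1 f) (!₂[ξ])

/-- The transform `B^{2,ν}`, from functions on `ℂ = ℝ²` to functions on `ℂ²`. -/
def segalBargmann2 (ν : ℝ) (h : ℂ → ℂ) (p : EuclideanSpace ℂ (Fin 2)) : ℂ :=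
  segalBargmann 2 ν (onR2 h) p

/-- The transform `G^ν f (z, w) = (ν/π)^(1/2) B^{1,ν} f ((z + i w)/√2)`. -/
def gTransform (ν : ℝ) (f : ℝ → ℂ) (p : EuclideanSpace ℂ (Fin 2)) : ℂ :=
  (((ν / Real.pi) ^ (1 / 2 : ℝ) : ℝ) : ℂ) *
    segalBargmann1 ν f ((p 0 + Complex.I * p 1) / ((Real.sqrt 2 : ℝ) : ℂ))

section Fock

variable (E : Type*) [NormedAddCommGroup E] [NormedSpace ℂ E] [MeasureSpace E]

/-- The entire functions on `E` which are square integrable for `exp (-ν |z|²) dλ(z)`. -/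
def fockSubmodule (ν : ℝ) : Submodule ℂ (E → ℂ) where
  carrier := {F | Differentiable ℂ F ∧ MemLp F 2 (gaussWeight E ν)}
  add_mem' hF hG := ⟨hF.1.add hG.1, hF.2.add hG.2⟩
  zero_mem' := ⟨differentiable_const 0, MemLp.zero⟩
  smul_mem' c _ hF := ⟨hF.1.const_smul c, hF.2.const_smul c⟩

/-- The Bargmann–Fock space `F^{2,ν}(E)`; below it gets the norm and the inner product of
`L²(E, exp (-ν |z|²) dλ)`. -/
def BargmannFock (ν : ℝ) : Type _ := ↥(fockSubmodule E ν)

namespace BargmannFock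

variable {E} {ν : ℝ}

instance : AddCommGroup (BargmannFock E ν) := inferInstanceAs (AddCommGroup ↥(fockSubmodule E ν))

instance : Module ℂ (BargmannFock E ν) := inferInstanceAs (Module ℂ ↥(fockSubmodule E ν))

instance : CoeFun (BargmannFock E ν) fun _ => E → ℂ := ⟨fun F => F.1⟩

/-- The class of a function of the Bargmann–Fock space in `L²(E, exp (-ν |z|²) dλ)`. -/
def toL2 : BargmannFock E ν →ₗ[ℂ] Lp ℂ 2 (gaussWeight E ν) where
  toFun F := F.2.2.toLp F.1
  map_add' _ _ := rfl
  map_smul' _ _ := rfl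

theorem toL2_injective [BorelSpace E] [(volume : Measure E).IsOpenPosMeasure] :
    Function.Injective (toL2 : BargmannFock E ν →ₗ[ℂ] Lp ℂ 2 (gaussWeight E ν)) := by
  intro F G h
  have h1 : (F.1 : E → ℂ) =ᵐ[gaussWeight E ν] G.1 := (MemLp.toLp_eq_toLp_iff F.2.2 G.2.2).1 h
  have h2 : (volume : Measure E) ≪ gaussWeight E ν := by
    refine withDensity_absolutelyContinuous' ?_ ?_
    · exact (ENNReal.continuous_ofReal.comp (by fun_prop : Continuous fun x : E =>
        Real.exp (-ν * ‖x‖ ^ 2))).measurable.aemeasurable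
    · exact Filter.Eventually.of_forall fun x => by simp [Real.exp_pos]
  exact Subtype.ext (Continuous.ae_eq_iff_eq volume F.2.1.continuous G.2.1.continuous |>.1
    (h2.ae_eq h1))

variable [BorelSpace E] [(volume : Measure E).IsOpenPosMeasure]

instance : NormedAddCommGroup (BargmannFock E ν) :=
  NormedAddCommGroup.induced _ _ (toL2 : BargmannFock E ν →ₗ[ℂ] _) toL2_injective

instance : InnerProductSpace ℂ (BargmannFock E ν) where
  norm_smul_le c F := by
    change ‖toL2 (c • F)‖ ≤ ‖c‖ * ‖toL2 F‖
    rw [map_smul, norm_smul]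
  inner F G := inner ℂ (toL2 F) (toL2 G)
  norm_sq_eq_re_inner F := norm_sq_eq_re_inner (𝕜 := ℂ) (toL2 F)
  conj_inner_symm F G := inner_conj_symm (toL2 F) (toL2 G)
  add_left F G H := by rw [map_add, inner_add_left]
  smul_left F G c := by rw [map_smul, inner_smul_left]

end BargmannFock

end Fock

end

/-! Write ξ = a + ib. Completing the square shows that, for fixed a, e^{-ν|ξ|²/2} |B¹f(ξ)| is a
constant times the modulus of the Fourier transform, at a frequency proportional to b, of f
localised by two Gaussians (`gaussWindow`). Plancherel in b, then Tonelli and a Gaussian integral in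
a, show that B¹ is isometric (`lintegral_segalBargmann1_sq`); B¹f is entire because it is a Gaussian
times a Laplace transform.

For G = B²B¹, put b = (z+iw)/√2 and a = (z-iw)/√2. The quadratic form in the kernel factors as
(ξ-b)(ξ̄-a), so with η = ξ-b the kernel is e^{-ν|η|²} times a function holomorphic in η. The mean
value property evaluates the integral at η = 0, leaving (ν/π)^{1/2} B¹f(b) (`segalBargmann2_eq`).

Finally (z,w) ↦ (b,a) is unitary and Gf depends on b alone; integrating out a gives π/ν, which
cancels the constant in G. -/

open MeasureTheory

noncomputable section

/-! ### Plancherel's theorem for the Fourier integral on L¹ ∩ L². -/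

section Plancherel

open FourierTransform SchwartzMap
open scoped ContDiff

variable {V : Type*} [NormedAddCommGroup V] [InnerProductSpace ℝ V] [FiniteDimensional ℝ V]
  [MeasurableSpace V] [BorelSpace V]

theorem integral_fourier_mul_eq {f g : V → ℂ} (hf : Integrable f) (hg : Integrable g) :
    ∫ x, 𝓕 f x * g x = ∫ x, f x * 𝓕 g x := by
  have := VectorFourier.integral_fourierIntegral_smul_eq_flip (L := innerₗ V)
    Real.continuous_fourierChar continuous_inner hf hg
  rw [flip_innerₗ] at this
  exact this

theorem continuous_fourier_of_integrable {f : V → ℂ} (hf : Integrable f) : Continuous (𝓕 f) :=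
  VectorFourier.fourierIntegral_continuous (L := innerₗ V) Real.continuous_fourierChar
    continuous_inner hf

/-- On `L¹ ∩ L²` the Fourier integral is a representative of the `L²` Fourier transform. -/
theorem coeFn_fourier_toLp_ae_eq {f : V → ℂ} (hf : Integrable f) (hf2 : MemLp f 2) :
    (𝓕 (hf2.toLp f) : Lp ℂ 2 (volume : Measure V)) =ᵐ[volume] 𝓕 f := by
  set T : Lp ℂ 2 (volume : Measure V) := 𝓕 (hf2.toLp f)
  have hT : LocallyIntegrable (T : V → ℂ) := (Lp.memLp T).locallyIntegrable (by norm_num)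
  have hF : LocallyIntegrable (𝓕 f) := (continuous_fourier_of_integrable hf).locallyIntegrable
  suffices h : ∀ᵐ x : V, (T : V → ℂ) x - 𝓕 f x = 0 from h.mono fun x hx => sub_eq_zero.1 hx
  refine ae_eq_zero_of_integral_contDiff_smul_eq_zero (hT.sub hF) fun g hg hgc => ?_
  have h1 : HasCompactSupport (Complex.ofRealCLM ∘ g) := hgc.comp_left rfl
  have h2 : ContDiff ℝ ∞ (Complex.ofRealCLM ∘ g) := Complex.ofRealCLM.contDiff.comp hg
  set φ : 𝓢(V, ℂ) := h1.toSchwartzMap h2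
  have hφ : ∀ x, φ x = (g x : ℂ) := fun x => rfl
  -- The distributional Fourier transform moves 𝓕 onto the test function; self-adjointness of the
  -- Fourier integral moves it back onto f.
  have key : ∫ x, φ x • (T : V → ℂ) x = ∫ x, φ x • 𝓕 f x := by
    rw [← Lp.toTemperedDistribution_apply, ← Lp.fourier_toTemperedDistribution_eq,
      TemperedDistribution.fourier_apply, Lp.toTemperedDistribution_apply]
    have h3 : ∫ x, 𝓕 φ x • (hf2.toLp f : V → ℂ) x = ∫ x, 𝓕 φ x • f x :=
      integral_congr_ae (hf2.coeFn_toLp.mono fun x hx => by simp only [hx])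
    rw [h3]
    exact integral_fourier_mul_eq φ.integrable hf
  have i1 : Integrable fun x => g x • (T : V → ℂ) x :=
    hT.integrable_smul_left_of_hasCompactSupport hg.continuous hgc
  have i2 : Integrable fun x => g x • 𝓕 f x :=
    hF.integrable_smul_left_of_hasCompactSupport hg.continuous hgc
  simp only [smul_sub]
  rw [integral_sub i1 i2, sub_eq_zero]
  simpa [hφ] using key

/-- Plancherel's theorem for the Fourier integral on `L¹ ∩ L²`. -/
theorem eLpNorm_fourier_eq {f : V → ℂ} (hf : Integrable f) (hf2 : MemLp f 2) :
    eLpNorm (𝓕 f) 2 = eLpNorm f 2 := by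
  rw [← eLpNorm_congr_ae (coeFn_fourier_toLp_ae_eq hf hf2), ← Lp.enorm_def, ← eLpNorm_congr_ae
    hf2.coeFn_toLp, ← Lp.enorm_def, ← ofReal_norm, ← ofReal_norm, Lp.norm_fourier_eq]

end Plancherel

/-! ### Weighted and unweighted L². -/

section GaussWeight

/-- Multiplying by the square root of the density, hence the exponent ν/2, carries the weighted L²
norm to the Lebesgue one. -/
theorem enorm_exp_half_mul_sq {E : Type*} [NormedAddCommGroup E] {ν : ℝ} (x : E) (w : ℂ) :
    ‖(Real.exp (-(ν / 2) * ‖x‖ ^ 2) : ℂ) * w‖ₑ ^ 2 =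
      ENNReal.ofReal (Real.exp (-ν * ‖x‖ ^ 2)) * ‖w‖ₑ ^ 2 := by
  rw [enorm_mul, mul_pow]
  congr 1
  rw [← ofReal_norm, Complex.norm_real, Real.norm_of_nonneg (Real.exp_pos _).le,
    ← ENNReal.ofReal_pow (Real.exp_pos _).le, ← Real.exp_nat_mul]
  congr 2
  push_cast
  ring

variable {E : Type*} [NormedAddCommGroup E] [MeasureSpace E] [BorelSpace E] {ν : ℝ}

theorem measurable_gaussDensity :
    Measurable fun x : E => ENNReal.ofReal (Real.exp (-ν * ‖x‖ ^ 2)) := by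
  fun_prop

theorem absolutelyContinuous_gaussWeight : (volume : Measure E) ≪ gaussWeight E ν :=
  withDensity_absolutelyContinuous' measurable_gaussDensity.aemeasurable
    (Filter.Eventually.of_forall fun x => by simp [Real.exp_pos])

theorem eLpNorm_two_sq {α : Type*} [MeasurableSpace α] {μ : Measure α} (f : α → ℂ) :
    eLpNorm f 2 μ ^ 2 = ∫⁻ x, ‖f x‖ₑ ^ 2 ∂μ := by
  simpa using eLpNorm_nnreal_pow_eq_lintegral (f := f) (μ := μ) (p := 2) (by norm_num)

theorem eLpNorm_two_eq_of_sq_eq {α β : Type*} [MeasurableSpace α] [MeasurableSpace β]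
    {μ : Measure α} {μ' : Measure β} {f : α → ℂ} {g : β → ℂ}
    (h : ∫⁻ x, ‖f x‖ₑ ^ 2 ∂μ = ∫⁻ x, ‖g x‖ₑ ^ 2 ∂μ') : eLpNorm f 2 μ = eLpNorm g 2 μ' := by
  rw [← eLpNorm_two_sq, ← eLpNorm_two_sq] at h
  exact (ENNReal.pow_right_strictMono two_ne_zero).injective h

theorem lintegral_gaussWeight_sq {f : E → ℂ} (hf : AEStronglyMeasurable f volume) :
    ∫⁻ x, ‖f x‖ₑ ^ 2 ∂gaussWeight E ν =
      ∫⁻ x, ENNReal.ofReal (Real.exp (-ν * ‖x‖ ^ 2)) * ‖f x‖ₑ ^ 2 :=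
  lintegral_withDensity_eq_lintegral_mul₀ measurable_gaussDensity.aemeasurable
    (hf.enorm.pow_const 2)

theorem eLpNorm_gaussWeight {f : E → ℂ} (hf : AEStronglyMeasurable f volume) :
    eLpNorm f 2 (gaussWeight E ν) =
      eLpNorm (fun x => (Real.exp (-(ν / 2) * ‖x‖ ^ 2) : ℂ) * f x) 2 volume := by
  apply eLpNorm_two_eq_of_sq_eq
  simp only [lintegral_gaussWeight_sq hf, enorm_exp_half_mul_sq]

theorem MeasureTheory.MemLp.exp_mul_of_gaussWeight {f : E → ℂ}
    (hf : MemLp f 2 (gaussWeight E ν)) :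
    MemLp (fun x => (Real.exp (-(ν / 2) * ‖x‖ ^ 2) : ℂ) * f x) 2 := by
  have h := hf.1.mono_ac absolutelyContinuous_gaussWeight
  refine ⟨AEStronglyMeasurable.mul (Continuous.aestronglyMeasurable (by fun_prop)) h, ?_⟩
  rw [← eLpNorm_gaussWeight h]
  exact hf.2

end GaussWeight

/-! ### Transport along linear isometries. -/

section Isometry

variable {E F : Type*} [NormedAddCommGroup E] [InnerProductSpace ℝ E] [FiniteDimensional ℝ E]
  [MeasurableSpace E] [BorelSpace E] [NormedAddCommGroup F] [InnerProductSpace ℝ F]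
  [FiniteDimensional ℝ F] [MeasurableSpace F] [BorelSpace F]

/-- The density depends only on the norm, and Lebesgue measure is invariant. -/
theorem LinearIsometryEquiv.measurePreserving_gaussWeight (e : E ≃ₗᵢ[ℝ] F) (ν : ℝ) :
    MeasurePreserving e (gaussWeight E ν) (gaussWeight F ν) := by
  refine ⟨e.continuous.measurable, ?_⟩
  ext s hs
  rw [Measure.map_apply e.continuous.measurable hs, gaussWeight, gaussWeight,
    withDensity_apply _ hs, withDensity_apply _ (e.continuous.measurable hs),
    ← e.measurePreserving.setLIntegral_comp_preimage hs measurable_gaussDensity]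
  simp

end Isometry

/-- The coordinate isometry `ℝ¹ → ℝ`. -/
def euclideanOneEquiv : EuclideanSpace ℝ (Fin 1) ≃ₗᵢ[ℝ] ℝ where
  toFun x := x 0
  invFun t := !₂[t]
  map_add' _ _ := rfl
  map_smul' _ _ := rfl
  left_inv x := by
    ext j
    simp [Subsingleton.elim j 0]
  right_inv _ := rfl
  norm_map' x := by
    simp only [EuclideanSpace.norm_eq, Finset.univ_unique, Fin.default_eq_zero,
      Finset.sum_singleton, Real.sqrt_sq (norm_nonneg _)]
    rfl

theorem euclideanOneEquiv_apply (x : EuclideanSpace ℝ (Fin 1)) : euclideanOneEquiv x = x 0 :=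
  rfl

/-- The isometry `ℝ² → ℂ`, `(x, y) ↦ x + i y`. -/
def euclideanTwoEquiv : EuclideanSpace ℝ (Fin 2) ≃ₗᵢ[ℝ] ℂ :=
  Complex.orthonormalBasisOneI.repr.symm

theorem euclideanTwoEquiv_apply (x : EuclideanSpace ℝ (Fin 2)) :
    euclideanTwoEquiv x = (x 0 : ℂ) + Complex.I * (x 1 : ℂ) := by
  simp [euclideanTwoEquiv, ← OrthonormalBasis.sum_repr_symm, mul_comm]

theorem onR1_eq_comp (f : ℝ → ℂ) : onR1 f = f ∘ euclideanOneEquiv := by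
  ext x
  simp [onR1, euclideanOneEquiv_apply]

theorem onR2_eq_comp (f : ℂ → ℂ) : onR2 f = f ∘ euclideanTwoEquiv := by
  ext x
  simp [onR2, euclideanTwoEquiv_apply]

/-! ### The kernel and absolute convergence. -/

section Kernel

variable {d : ℕ} {ν : ℝ}

theorem sqrt_two_cast_sq : ((Real.sqrt 2 : ℝ) : ℂ) ^ 2 = 2 := by
  rw [← Complex.ofReal_pow, Real.sq_sqrt zero_le_two]
  norm_num

theorem sqrt_two_cast_ne_zero : ((Real.sqrt 2 : ℝ) : ℂ) ≠ 0 := by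
  simp

theorem sum_sub_div_sqrt_two_sq (z : EuclideanSpace ℂ (Fin d)) (x : EuclideanSpace ℝ (Fin d)) :
    ∑ j, ((x j : ℂ) - z j / ((Real.sqrt 2 : ℝ) : ℂ)) ^ 2 =
      (‖x‖ : ℂ) ^ 2 - (Real.sqrt 2 : ℝ) * ∑ j, (x j : ℂ) * z j + (∑ j, z j ^ 2) / 2 := by
  have h : ((‖x‖ : ℝ) : ℂ) ^ 2 = ∑ j, (x j : ℂ) ^ 2 := by
    rw [← Complex.ofReal_pow, EuclideanSpace.real_norm_sq_eq]
    push_cast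
    rfl
  rw [h, Finset.mul_sum, Finset.sum_div, ← Finset.sum_sub_distrib, ← Finset.sum_add_distrib]
  refine Finset.sum_congr rfl fun j _ => ?_
  field_simp
  linear_combination (-(2 * (x j : ℂ) * z j * ((Real.sqrt 2 : ℝ) : ℂ)) + z j ^ 2)
    * (-sqrt_two_cast_sq)

theorem sbKernel_eq (z : EuclideanSpace ℂ (Fin d)) (x : EuclideanSpace ℝ (Fin d)) :
    sbKernel d ν z x = (((ν / Real.pi) ^ (3 * (d : ℝ) / 4) : ℝ) : ℂ) *
      Complex.exp (-(ν / 2) * ∑ j, z j ^ 2) *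
      Complex.exp (-ν * (‖x‖ : ℂ) ^ 2 + ν * (Real.sqrt 2 : ℝ) * ∑ j, (x j : ℂ) * z j) := by
  rw [sbKernel, sum_sub_div_sqrt_two_sq, mul_assoc, ← Complex.exp_add]
  congr 2
  ring

theorem continuous_sbKernel (z : EuclideanSpace ℂ (Fin d)) : Continuous (sbKernel d ν z) := by
  unfold sbKernel
  fun_prop

/-- The kernel decays like e^{-ν|x|²} up to the exponential of a linear term, so half of the
Gaussian decay survives the factor e^{ν|x|²/2}. -/
theorem memLp_exp_mul_sbKernel (hν : 0 < ν) (z : EuclideanSpace ℂ (Fin d)) :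
    MemLp (fun x => (Real.exp (ν / 2 * ‖x‖ ^ 2) : ℂ) * sbKernel d ν z x) 2 := by
  have hc : Continuous fun x => (Real.exp (ν / 2 * ‖x‖ ^ 2) : ℂ) * sbKernel d ν z x :=
    Continuous.mul (by fun_prop) (continuous_sbKernel z)
  rw [memLp_two_iff_integrable_sq_norm hc.aestronglyMeasurable]
  -- The squared modulus has exponent -ν|x|² + 2√2 ν ⟨Re z, x⟩, up to a constant.
  have hi := (GaussianFourier.integrable_cexp_neg_mul_sq_norm_add (b := (ν : ℂ)) (by simpa)
    ((2 * ν * Real.sqrt 2 : ℝ) : ℂ)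
    (WithLp.toLp 2 fun j => (z j).re : EuclideanSpace ℝ (Fin d))).norm
  refine (hi.const_mul (‖(((ν / Real.pi) ^ (3 * (d : ℝ) / 4) : ℝ) : ℂ) *
      Complex.exp (-(ν / 2) * ∑ j, z j ^ 2)‖ ^ 2)).congr (Filter.Eventually.of_forall fun x => ?_)
  simp only
  rw [sbKernel_eq, mul_left_comm]
  generalize (((ν / Real.pi) ^ (3 * (d : ℝ) / 4) : ℝ) : ℂ) *
    Complex.exp (-(ν / 2) * ∑ j, z j ^ 2) = A
  rw [norm_mul A, mul_pow]
  congr 1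
  rw [Complex.ofReal_exp, ← Complex.exp_add, Complex.norm_exp, Complex.norm_exp, ← Real.exp_nat_mul]
  congr 1
  have h : (inner ℝ (WithLp.toLp 2 fun j => (z j).re : EuclideanSpace ℝ (Fin d)) x) =
      (∑ j, (x j : ℂ) * z j).re := by
    simp [PiLp.inner_apply]
  have h2 : ((ν : ℂ) * (Real.sqrt 2 : ℝ) * ∑ j, (x j : ℂ) * z j).re =
      ν * Real.sqrt 2 * (∑ j, (x j : ℂ) * z j).re := by
    rw [← Complex.ofReal_mul, Complex.re_ofReal_mul]
  have h3 : (-(ν : ℂ) * (‖x‖ : ℂ) ^ 2).re = -ν * ‖x‖ ^ 2 := by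
    rw [← Complex.ofReal_pow, ← Complex.ofReal_neg, ← Complex.ofReal_mul, Complex.ofReal_re]
  rw [Complex.add_re, Complex.add_re, Complex.add_re, h2, h3, ← h, Complex.ofReal_re,
    ← Complex.ofReal_mul, Complex.ofReal_re]
  push_cast
  ring

/-- Cauchy–Schwarz for e^{-ν|x|²/2} f and e^{ν|x|²/2} times the kernel. -/
theorem integrable_mul_sbKernel (hν : 0 < ν) {f : EuclideanSpace ℝ (Fin d) → ℂ}
    (hf : MemLp f 2 (gaussWeight _ ν)) (z : EuclideanSpace ℂ (Fin d)) :
    Integrable fun x => f x * sbKernel d ν z x := by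
  refine (hf.exp_mul_of_gaussWeight.integrable_mul (memLp_exp_mul_sbKernel hν z)).congr
    (Filter.Eventually.of_forall fun x => ?_)
  have h : (Real.exp (-(ν / 2) * ‖x‖ ^ 2) : ℂ) * Real.exp (ν / 2 * ‖x‖ ^ 2) = 1 := by
    rw [← Complex.ofReal_mul, ← Real.exp_add]
    simp
  simp only [Pi.mul_apply]
  linear_combination (f x * sbKernel d ν z x) * h

theorem integrable_onR1_mul_sbKernel (hν : 0 < ν) {f : ℝ → ℂ} (hf : MemLp f 2 (gaussWeight ℝ ν))
    (z : EuclideanSpace ℂ (Fin 1)) : Integrable fun x => onR1 f x * sbKernel 1 ν z x := by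
  refine integrable_mul_sbKernel hν ?_ z
  rw [onR1_eq_comp]
  exact hf.comp_measurePreserving (euclideanOneEquiv.measurePreserving_gaussWeight ν)

theorem integrable_onR2_mul_sbKernel (hν : 0 < ν) {F : ℂ → ℂ} (hF : MemLp F 2 (gaussWeight ℂ ν))
    (z : EuclideanSpace ℂ (Fin 2)) : Integrable fun x => onR2 F x * sbKernel 2 ν z x := by
  refine integrable_mul_sbKernel hν ?_ z
  rw [onR2_eq_comp]
  exact hF.comp_measurePreserving (euclideanTwoEquiv.measurePreserving_gaussWeight ν)

end Kernel

/-! ### The one-variable transform as an integral over ℝ. -/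

section OneVariable

variable {ν : ℝ}

/-- The constant and the `z`-dependent Gaussian factor of the kernel in one variable. -/
def sbFactor (ν : ℝ) (ξ : ℂ) : ℂ :=
  (((ν / Real.pi) ^ (3 / 4 : ℝ) : ℝ) : ℂ) * Complex.exp (-(ν / 2) * ξ ^ 2)

/-- The `x`-dependent factor of the kernel in one variable. -/
def sbExp (ν : ℝ) (ξ : ℂ) (x : ℝ) : ℂ :=
  Complex.exp (-ν * (x : ℂ) ^ 2 + ν * (Real.sqrt 2 : ℝ) * (x * ξ))

theorem sbKernel_one_eq (ξ : ℂ) (x : EuclideanSpace ℝ (Fin 1)) :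
    sbKernel 1 ν (!₂[ξ]) x = sbFactor ν ξ * sbExp ν ξ (euclideanOneEquiv x) := by
  have h : ((‖x‖ : ℝ) : ℂ) ^ 2 = ((euclideanOneEquiv x : ℝ) : ℂ) ^ 2 := by
    rw [← euclideanOneEquiv.norm_map, ← Complex.ofReal_pow, Real.norm_eq_abs, sq_abs,
      Complex.ofReal_pow]
  rw [sbKernel_eq, h]
  simp [sbFactor, sbExp, euclideanOneEquiv_apply]

theorem segalBargmann1_eq (f : ℝ → ℂ) (ξ : ℂ) :
    segalBargmann1 ν f ξ = sbFactor ν ξ * ∫ x, f x * sbExp ν ξ x := by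
  rw [segalBargmann1, segalBargmann, onR1_eq_comp, ← integral_const_mul,
    ← euclideanOneEquiv.measurePreserving.integral_comp
      euclideanOneEquiv.toHomeomorph.measurableEmbedding]
  simp only [sbKernel_one_eq, Function.comp_apply]
  congr 1
  ext x
  ring

theorem sbFactor_ne_zero (hν : 0 < ν) (ξ : ℂ) : sbFactor ν ξ ≠ 0 := by
  refine mul_ne_zero ?_ (Complex.exp_ne_zero _)
  exact_mod_cast (Real.rpow_pos_of_pos (div_pos hν Real.pi_pos) _).ne'

theorem integrable_mul_sbExp (hν : 0 < ν) {f : ℝ → ℂ} (hf : MemLp f 2 (gaussWeight ℝ ν)) (ξ : ℂ) :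
    Integrable fun x => f x * sbExp ν ξ x := by
  have h := integrable_onR1_mul_sbKernel hν hf (!₂[ξ])
  rw [← euclideanOneEquiv.measurePreserving.integrable_comp_emb
      euclideanOneEquiv.toHomeomorph.measurableEmbedding]
  refine (h.const_mul (sbFactor ν ξ)⁻¹).congr (Filter.Eventually.of_forall fun x => ?_)
  simp only [sbKernel_one_eq, onR1_eq_comp, Function.comp_apply]
  field_simp [sbFactor_ne_zero hν ξ]

end OneVariable

/-! ### Holomorphy of two-sided Laplace transforms. -/

section Laplace

theorem exp_mul_abs_le (s x : ℝ) : Real.exp (s * |x|) ≤ Real.exp (s * x) + Real.exp (-s * x) := by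
  rcases abs_cases x with h | h
  · rw [h.1]
    linarith [Real.exp_pos (-s * x)]
  · rw [h.1, mul_neg, ← neg_mul]
    linarith [Real.exp_pos (s * x)]

/-- The two-sided Laplace transform is entire if it converges absolutely everywhere. -/
theorem differentiable_integral_mul_cexp {h : ℝ → ℂ} (hm : AEStronglyMeasurable h)
    (hi : ∀ s : ℝ, Integrable fun x : ℝ => h x * Complex.exp (x * (s : ℂ))) :
    Differentiable ℂ fun ξ : ℂ => ∫ x : ℝ, h x * Complex.exp (x * ξ) := by
  have hb : ∀ s : ℝ, Integrable fun x : ℝ => ‖h x‖ * (Real.exp (s * x) + Real.exp (-s * x)) := by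
    intro s
    refine ((hi s).norm.add (hi (-s)).norm).congr (Filter.Eventually.of_forall fun x => ?_)
    simp [Complex.norm_exp, mul_add, mul_comm x]
  have hmeas : ∀ ξ : ℂ, AEStronglyMeasurable fun x : ℝ => h x * Complex.exp (x * ξ) :=
    fun ξ => hm.mul (Continuous.aestronglyMeasurable (by fun_prop))
  have hint : ∀ ξ : ℂ, Integrable fun x : ℝ => h x * Complex.exp (x * ξ) := by
    intro ξ
    refine (hi ξ.re).norm.mono' (hmeas ξ) (Filter.Eventually.of_forall fun x => ?_)
    simp [Complex.norm_exp]
  intro ξ₀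
  -- On the unit ball about ξ₀ the exponential is at most e^{(‖ξ₀‖+1)|x|}; the factor x from
  -- differentiation costs another e^{|x|}, hence ‖ξ₀‖ + 2.
  refine (hasDerivAt_integral_of_dominated_loc_of_deriv_le
    (F' := fun ξ x => h x * (Complex.exp (x * ξ) * x))
    (bound := fun x => ‖h x‖ * (Real.exp ((‖ξ₀‖ + 2) * x) + Real.exp (-(‖ξ₀‖ + 2) * x)))
    (Metric.ball_mem_nhds ξ₀ one_pos) (Filter.Eventually.of_forall hmeas) (hint ξ₀)
    (hm.mul (Continuous.aestronglyMeasurable (by fun_prop)))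
    (Filter.Eventually.of_forall fun x ξ hξ => ?_) (hb _)
    (Filter.Eventually.of_forall fun x ξ _ => ?_)).2.differentiableAt
  · rw [norm_mul, norm_mul, Complex.norm_exp, Complex.norm_real, Real.norm_eq_abs]
    refine mul_le_mul_of_nonneg_left (le_trans ?_ (exp_mul_abs_le _ x)) (norm_nonneg _)
    have h1 : |x| ≤ Real.exp |x| := by linarith [Real.add_one_le_exp |x|]
    have h2 : ‖ξ‖ ≤ ‖ξ₀‖ + 1 := by
      have := norm_sub_norm_le ξ ξ₀
      rw [mem_ball_iff_norm] at hξ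
      linarith
    have h3 : ((x : ℂ) * ξ).re ≤ (‖ξ₀‖ + 1) * |x| := by
      refine (Complex.re_le_norm _).trans ?_
      rw [norm_mul, Complex.norm_real, Real.norm_eq_abs, mul_comm]
      exact mul_le_mul_of_nonneg_right h2 (abs_nonneg x)
    calc _ ≤ Real.exp ((‖ξ₀‖ + 1) * |x|) * Real.exp |x| :=
          mul_le_mul (Real.exp_le_exp.2 h3) h1 (abs_nonneg x) (Real.exp_pos _).le
      _ = _ := by
          rw [← Real.exp_add]
          congr 1
          ring
  · have h1 : HasDerivAt (fun ξ : ℂ => (x : ℂ) * ξ) x ξ := by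
      simpa using (hasDerivAt_id ξ).const_mul (x : ℂ)
    exact h1.cexp.const_mul (h x)

end Laplace

/-! ### Holomorphy of B¹f. -/

section OneVariable

variable {ν : ℝ}

theorem differentiable_segalBargmann1 (hν : 0 < ν) {f : ℝ → ℂ}
    (hf : MemLp f 2 (gaussWeight ℝ ν)) : Differentiable ℂ (segalBargmann1 ν f) := by
  have hs : ∀ (x : ℝ) (ξ : ℂ), sbExp ν ξ x =
      Complex.exp (-ν * (x : ℂ) ^ 2) * Complex.exp (x * (ν * (Real.sqrt 2 : ℝ) * ξ)) := by
    intro x ξ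
    rw [sbExp, ← Complex.exp_add]
    congr 1
    ring
  have h1 : Differentiable ℂ fun ξ : ℂ =>
      ∫ x : ℝ, f x * Complex.exp (-ν * (x : ℂ) ^ 2) * Complex.exp (x * ξ) := by
    refine differentiable_integral_mul_cexp
      ((hf.1.mono_ac absolutelyContinuous_gaussWeight).mul
        (Continuous.aestronglyMeasurable (by fun_prop))) fun s => ?_
    -- At this ξ the linear exponent of `sbExp` is exactly xs.
    refine (integrable_mul_sbExp hν hf (s / (ν * (Real.sqrt 2 : ℝ)))).congr
      (Filter.Eventually.of_forall fun x => ?_)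
    simp only
    rw [hs, mul_div_cancel₀, mul_assoc]
    exact mul_ne_zero (by exact_mod_cast hν.ne') sqrt_two_cast_ne_zero
  have h2 : Differentiable ℂ fun ξ : ℂ => (ν : ℂ) * (Real.sqrt 2 : ℝ) * ξ := by fun_prop
  have h3 : Differentiable ℂ (sbFactor ν) := by
    unfold sbFactor
    fun_prop
  have h4 := h3.mul (h1.comp h2)
  refine fun ξ => (h4 ξ).congr_of_eventuallyEq (Filter.Eventually.of_forall fun ξ => ?_)
  simp only [segalBargmann1_eq, hs, Pi.mul_apply, Function.comp_apply, mul_assoc]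

end OneVariable

/-! ### B¹ is isometric. -/

section OneVariableNorm

open FourierTransform

variable {ν : ℝ}

theorem lintegral_comp_mul_left {a : ℝ} (ha : a ≠ 0) {f : ℝ → ENNReal} (hf : Measurable f) :
    ∫⁻ x, f (a * x) = ENNReal.ofReal |a⁻¹| * ∫⁻ x, f x := by
  rw [← lintegral_map hf (measurable_const_mul a), Real.map_volume_mul_left ha,
    lintegral_smul_measure, smul_eq_mul]

theorem lintegral_exp_neg_mul_norm_sq {V : Type*} [NormedAddCommGroup V] [InnerProductSpace ℝ V]
    [FiniteDimensional ℝ V] [MeasurableSpace V] [BorelSpace V] (hν : 0 < ν) :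
    ∫⁻ v : V, ENNReal.ofReal (Real.exp (-ν * ‖v‖ ^ 2)) =
      ENNReal.ofReal ((Real.pi / ν) ^ ((Module.finrank ℝ V : ℝ) / 2)) := by
  rw [← GaussianFourier.integral_rexp_neg_mul_sq_norm hν, ofReal_integral_eq_lintegral_ofReal]
  · have h := (GaussianFourier.integrable_cexp_neg_mul_sq_norm_add (b := (ν : ℂ)) (V := V)
      (by simpa) 0 0).norm
    refine h.congr (Filter.Eventually.of_forall fun x => ?_)
    have h3 : (-(ν : ℂ) * (‖x‖ : ℂ) ^ 2).re = -ν * ‖x‖ ^ 2 := by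
      rw [← Complex.ofReal_pow, ← Complex.ofReal_neg, ← Complex.ofReal_mul, Complex.ofReal_re]
    simp only [zero_mul, add_zero, Complex.norm_exp, h3]
  · exact Filter.Eventually.of_forall fun x => (Real.exp_pos _).le

/-- Independence of x is what recovers the norm of f after averaging over the window position a. -/
theorem lintegral_exp_sub_sqrt_two_mul (hν : 0 < ν) (x : ℝ) :
    ∫⁻ a : ℝ, ENNReal.ofReal (Real.exp (-ν * (x - Real.sqrt 2 * a) ^ 2)) =
      ENNReal.ofReal ((Real.sqrt 2)⁻¹ * (Real.pi / ν) ^ (1 / 2 : ℝ)) := by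
  have h2 : (0 : ℝ) < Real.sqrt 2 := by positivity
  rw [lintegral_comp_mul_left (f := fun t => ENNReal.ofReal (Real.exp (-ν * (x - t) ^ 2))) h2.ne'
    (by fun_prop), lintegral_sub_left_eq_self (fun t => ENNReal.ofReal (Real.exp (-ν * t ^ 2))) x,
    ENNReal.ofReal_mul (by positivity), abs_of_pos (by positivity)]
  have := lintegral_exp_neg_mul_norm_sq (V := ℝ) hν
  simpa using congrArg (ENNReal.ofReal (Real.sqrt 2)⁻¹ * ·) this

/-- `f` localised by Gaussians at the origin and at `√2 a`. -/
def gaussWindow (ν : ℝ) (f : ℝ → ℂ) (a x : ℝ) : ℂ :=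
  (Real.exp (-(ν / 2) * (x - Real.sqrt 2 * a) ^ 2) : ℂ) *
    ((Real.exp (-(ν / 2) * ‖x‖ ^ 2) : ℂ) * f x)

theorem memLp_gaussWindow {f : ℝ → ℂ} (hν : 0 < ν) (hf : MemLp f 2 (gaussWeight ℝ ν)) (a : ℝ) :
    MemLp (gaussWindow ν f a) 2 := by
  refine hf.exp_mul_of_gaussWeight.of_le ?_ (Filter.Eventually.of_forall fun x => ?_)
  · exact AEStronglyMeasurable.mul (Continuous.aestronglyMeasurable (by fun_prop))
      hf.exp_mul_of_gaussWeight.1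
  · rw [gaussWindow, norm_mul, Complex.norm_real, Real.norm_of_nonneg (Real.exp_pos _).le]
    refine mul_le_of_le_one_left (norm_nonneg _) (Real.exp_le_one_iff.2 ?_)
    have : 0 ≤ ν / 2 * (x - Real.sqrt 2 * a) ^ 2 := by positivity
    linarith

/-- Completing the square: -νx² + √2νax - νa² = -(ν/2)(x-√2a)² - (ν/2)x². The parameter b enters
only as an oscillation. -/
theorem gaussWindow_eq (f : ℝ → ℂ) (a b x : ℝ) :
    Complex.exp ((ν * Real.sqrt 2 * (x * b) : ℝ) * Complex.I) * gaussWindow ν f a x =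
      Complex.exp (-ν * (a : ℂ) ^ 2) * (f x * sbExp ν (a + b * Complex.I) x) := by
  rw [gaussWindow, sbExp, Real.norm_eq_abs, sq_abs, Complex.ofReal_exp, Complex.ofReal_exp]
  have h : Complex.exp ((ν * Real.sqrt 2 * (x * b) : ℝ) * Complex.I) *
      (Complex.exp ((-(ν / 2) * (x - Real.sqrt 2 * a) ^ 2 : ℝ)) *
        Complex.exp ((-(ν / 2) * x ^ 2 : ℝ))) =
      Complex.exp (-ν * (a : ℂ) ^ 2) * Complex.exp (-ν * (x : ℂ) ^ 2 +
        ν * (Real.sqrt 2 : ℝ) * (x * (a + b * Complex.I))) := by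
    rw [← Complex.exp_add, ← Complex.exp_add, ← Complex.exp_add]
    congr 1
    push_cast
    linear_combination (-(ν : ℂ) / 2 * a ^ 2) * sqrt_two_cast_sq
  linear_combination f x * h

/-- The case b = 0 of `gaussWindow_eq`. Plancherel is available on L¹ ∩ L², so `memLp_gaussWindow`
alone is not enough. -/
theorem integrable_gaussWindow {f : ℝ → ℂ} (hν : 0 < ν) (hf : MemLp f 2 (gaussWeight ℝ ν))
    (a : ℝ) : Integrable (gaussWindow ν f a) := by
  refine ((integrable_mul_sbExp hν hf a).const_mul (Complex.exp (-ν * (a : ℂ) ^ 2))).congr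
    (Filter.Eventually.of_forall fun x => ?_)
  have := gaussWindow_eq (ν := ν) f a 0 x
  simp only [mul_zero, Complex.ofReal_zero, zero_mul, Complex.exp_zero, one_mul, add_zero] at this
  exact this.symm

theorem fourier_gaussWindow (f : ℝ → ℂ) (a b : ℝ) :
    𝓕 (gaussWindow ν f a) (-(ν * Real.sqrt 2 / (2 * Real.pi)) * b) =
      Complex.exp (-ν * (a : ℂ) ^ 2) * ∫ x, f x * sbExp ν (a + b * Complex.I) x := by
  rw [Real.fourier_eq', ← integral_const_mul]
  congr 1
  ext x
  rw [← gaussWindow_eq, smul_eq_mul]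
  congr 4
  simp only [RCLike.inner_apply, conj_trivial]
  field_simp [Real.pi_ne_zero]

/-- Since Re ξ² = a² - b², the weight e^{-ν(a²+b²)} cancels all dependence on b. -/
theorem norm_sbFactor_sq (hν : 0 < ν) (a b : ℝ) :
    ‖sbFactor ν (a + b * Complex.I)‖ ^ 2 * Real.exp (-ν * ‖(a + b * Complex.I : ℂ)‖ ^ 2) =
      (ν / Real.pi) ^ (3 / 2 : ℝ) * Real.exp (-ν * a ^ 2) ^ 2 := by
  have h0 : 0 < ν / Real.pi := div_pos hν Real.pi_pos
  have h1 : ‖(a + b * Complex.I : ℂ)‖ ^ 2 = a ^ 2 + b ^ 2 := by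
    rw [Complex.sq_norm, Complex.normSq_add_mul_I]
  have h2 : (-(ν / 2 : ℂ) * (a + b * Complex.I) ^ 2).re = -(ν / 2) * (a ^ 2 - b ^ 2) := by
    have : (-(ν / 2 : ℂ) * (a + b * Complex.I) ^ 2) =
        ((-(ν / 2) * (a ^ 2 - b ^ 2) : ℝ) : ℂ) + ((-ν * a * b : ℝ) : ℂ) * Complex.I := by
      push_cast
      linear_combination (-(ν / 2 : ℂ) * b ^ 2) * Complex.I_sq
    rw [this, Complex.add_re, Complex.ofReal_re, Complex.re_ofReal_mul, Complex.I_re, mul_zero,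
      add_zero]
  rw [sbFactor, norm_mul, Complex.norm_exp, Complex.norm_real,
    Real.norm_of_nonneg (Real.rpow_nonneg h0.le _), h1, h2, mul_pow, ← Real.rpow_mul_natCast h0.le,
    mul_assoc, ← Real.exp_nat_mul, ← Real.exp_nat_mul, ← Real.exp_add]
  congr 2
  · norm_num
  · push_cast
    ring

theorem density_mul_segalBargmann1_sq (hν : 0 < ν) (f : ℝ → ℂ) (a b : ℝ) :
    ENNReal.ofReal (Real.exp (-ν * ‖(a + b * Complex.I : ℂ)‖ ^ 2)) *
        ‖segalBargmann1 ν f (a + b * Complex.I)‖ₑ ^ 2 =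
      ENNReal.ofReal ((ν / Real.pi) ^ (3 / 2 : ℝ)) *
        ‖𝓕 (gaussWindow ν f a) (-(ν * Real.sqrt 2 / (2 * Real.pi)) * b)‖ₑ ^ 2 := by
  have h0 : 0 < ν / Real.pi := div_pos hν Real.pi_pos
  have h2 : (-(ν : ℂ) * (a : ℂ) ^ 2).re = -ν * a ^ 2 := by
    rw [← Complex.ofReal_pow, ← Complex.ofReal_neg, ← Complex.ofReal_mul, Complex.ofReal_re]
  rw [fourier_gaussWindow, segalBargmann1_eq, ← ofReal_norm, ← ofReal_norm,
    ← ENNReal.ofReal_pow (norm_nonneg _), ← ENNReal.ofReal_pow (norm_nonneg _),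
    ← ENNReal.ofReal_mul (Real.exp_pos _).le, ← ENNReal.ofReal_mul (Real.rpow_nonneg h0.le _),
    norm_mul, norm_mul, Complex.norm_exp, h2]
  congr 1
  linear_combination ‖∫ x, f x * sbExp ν (a + b * Complex.I) x‖ ^ 2 * norm_sbFactor_sq hν a b

/-- The factors are the squared kernel constant, the Jacobian of the frequency scaling and the
Gaussian integral over a. -/
theorem norm_segalBargmann1_constant (hν : 0 < ν) :
    (ν / Real.pi) ^ (3 / 2 : ℝ) * (2 * Real.pi / (ν * Real.sqrt 2)) *
      ((Real.sqrt 2)⁻¹ * (Real.pi / ν) ^ (1 / 2 : ℝ)) = 1 := by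
  have h0 : 0 < ν / Real.pi := div_pos hν Real.pi_pos
  have h1 : (Real.pi / ν) ^ (1 / 2 : ℝ) = ((ν / Real.pi) ^ (1 / 2 : ℝ))⁻¹ := by
    rw [← Real.inv_rpow h0.le, inv_div]
  have h2 : (ν / Real.pi) ^ (3 / 2 : ℝ) = (ν / Real.pi) * (ν / Real.pi) ^ (1 / 2 : ℝ) := by
    rw [← Real.rpow_one_add' h0.le (by norm_num)]
    norm_num
  have h3 : Real.sqrt 2 * Real.sqrt 2 = 2 := Real.mul_self_sqrt zero_le_two
  have h4 : 0 < (ν / Real.pi) ^ (1 / 2 : ℝ) := Real.rpow_pos_of_pos h0 _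
  rw [h1, h2]
  generalize (ν / Real.pi) ^ (1 / 2 : ℝ) = c at *
  field_simp [hν.ne', Real.pi_ne_zero]
  linarith [h3]

theorem lintegral_segalBargmann1_sq (hν : 0 < ν) {f : ℝ → ℂ} (hf : MemLp f 2 (gaussWeight ℝ ν)) :
    ∫⁻ ξ, ‖segalBargmann1 ν f ξ‖ₑ ^ 2 ∂gaussWeight ℂ ν =
      ∫⁻ x, ‖f x‖ₑ ^ 2 ∂gaussWeight ℝ ν := by
  have h0 : 0 < ν / Real.pi := div_pos hν Real.pi_pos
  have hc : Continuous (segalBargmann1 ν f) := (differentiable_segalBargmann1 hν hf).continuous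
  have hfm : AEStronglyMeasurable f := hf.1.mono_ac absolutelyContinuous_gaussWeight
  have hk : -(ν * Real.sqrt 2 / (2 * Real.pi)) ≠ 0 := by
    have := Real.pi_pos
    have : (0 : ℝ) < Real.sqrt 2 := by positivity
    exact neg_ne_zero.2 (by positivity)
  -- Plancherel in b on the vertical line Re ξ = a.
  have hinner : ∀ a : ℝ, ∫⁻ b : ℝ, ‖𝓕 (gaussWindow ν f a)
      (-(ν * Real.sqrt 2 / (2 * Real.pi)) * b)‖ₑ ^ 2 =
      ENNReal.ofReal (2 * Real.pi / (ν * Real.sqrt 2)) *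
        ∫⁻ x, ENNReal.ofReal (Real.exp (-ν * (x - Real.sqrt 2 * a) ^ 2)) *
          ‖(Real.exp (-(ν / 2) * ‖x‖ ^ 2) : ℂ) * f x‖ₑ ^ 2 := by
    intro a
    have hi := integrable_gaussWindow hν hf a
    rw [lintegral_comp_mul_left (f := fun w => ‖𝓕 (gaussWindow ν f a) w‖ₑ ^ 2) hk
      ((continuous_fourier_of_integrable hi).enorm.measurable.pow_const 2), inv_neg, abs_neg,
      inv_div, abs_of_pos (by have := Real.pi_pos; positivity), ← eLpNorm_two_sq,
      eLpNorm_fourier_eq hi (memLp_gaussWindow hν hf a), eLpNorm_two_sq]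
    congr 2
    ext x
    have := enorm_exp_half_mul_sq (ν := ν) (x - Real.sqrt 2 * a)
      ((Real.exp (-(ν / 2) * ‖x‖ ^ 2) : ℂ) * f x)
    rw [Real.norm_eq_abs (x - _), sq_abs] at this
    exact this
  -- Tonelli: integrating over a first removes the moving window.
  have hswap : ∫⁻ a : ℝ, ∫⁻ x, ENNReal.ofReal (Real.exp (-ν * (x - Real.sqrt 2 * a) ^ 2)) *
      ‖(Real.exp (-(ν / 2) * ‖x‖ ^ 2) : ℂ) * f x‖ₑ ^ 2 =
      ENNReal.ofReal ((Real.sqrt 2)⁻¹ * (Real.pi / ν) ^ (1 / 2 : ℝ)) *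
        ∫⁻ x, ‖f x‖ₑ ^ 2 ∂gaussWeight ℝ ν := by
    rw [lintegral_lintegral_swap]
    · rw [lintegral_gaussWeight_sq hfm, ← lintegral_const_mul' _ _ ENNReal.ofReal_ne_top]
      congr 1
      ext x
      rw [lintegral_mul_const' _ _ (ENNReal.pow_ne_top enorm_ne_top), lintegral_exp_sub_sqrt_two_mul hν,
        enorm_exp_half_mul_sq]
    · have hg : Measurable fun q : ℝ × ℝ =>
          ENNReal.ofReal (Real.exp (-ν * (q.2 - Real.sqrt 2 * q.1) ^ 2)) := by fun_prop
      refine hg.aemeasurable.mul ?_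
      exact (hf.exp_mul_of_gaussWeight.1.comp_snd (μ := volume)).enorm.pow_const 2
  rw [lintegral_gaussWeight_sq hc.aestronglyMeasurable,
    ← Complex.volume_preserving_equiv_real_prod.symm.lintegral_comp_emb
      Complex.measurableEquivRealProd.symm.measurableEmbedding, Measure.volume_eq_prod,
    lintegral_prod _ (Measurable.aemeasurable ?_)]
  · have hpt : ∀ a b : ℝ, Complex.measurableEquivRealProd.symm (a, b) = a + b * Complex.I :=
      fun a b => Complex.mk_eq_add_mul_I a b
    simp only [hpt, density_mul_segalBargmann1_sq hν]
    calc _ = ∫⁻ a : ℝ, ENNReal.ofReal ((ν / Real.pi) ^ (3 / 2 : ℝ)) *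
          (ENNReal.ofReal (2 * Real.pi / (ν * Real.sqrt 2)) *
          ∫⁻ x, ENNReal.ofReal (Real.exp (-ν * (x - Real.sqrt 2 * a) ^ 2)) *
          ‖(Real.exp (-(ν / 2) * ‖x‖ ^ 2) : ℂ) * f x‖ₑ ^ 2) := by
          congr 1
          ext a
          rw [lintegral_const_mul' _ _ ENNReal.ofReal_ne_top, hinner]
      _ = _ := by
          rw [lintegral_const_mul' _ _ ENNReal.ofReal_ne_top,
            lintegral_const_mul' _ _ ENNReal.ofReal_ne_top, hswap, ← mul_assoc, ← mul_assoc,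
            ← ENNReal.ofReal_mul (by positivity), ← ENNReal.ofReal_mul (by positivity),
            norm_segalBargmann1_constant hν, ENNReal.ofReal_one, one_mul]
  · exact Measurable.comp (g := fun ξ : ℂ => ENNReal.ofReal (Real.exp (-ν * ‖ξ‖ ^ 2)) *
      ‖segalBargmann1 ν f ξ‖ₑ ^ 2) (measurable_gaussDensity.mul (hc.enorm.measurable.pow_const 2))
      Complex.measurableEquivRealProd.symm.measurable

theorem eLpNorm_segalBargmann1 (hν : 0 < ν) {f : ℝ → ℂ} (hf : MemLp f 2 (gaussWeight ℝ ν)) :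
    eLpNorm (segalBargmann1 ν f) 2 (gaussWeight ℂ ν) = eLpNorm f 2 (gaussWeight ℝ ν) :=
  eLpNorm_two_eq_of_sq_eq (lintegral_segalBargmann1_sq hν hf)

theorem segalBargmann1_mem_fockSubmodule (hν : 0 < ν) {f : ℝ → ℂ}
    (hf : MemLp f 2 (gaussWeight ℝ ν)) : segalBargmann1 ν f ∈ fockSubmodule ℂ ν := by
  have hd := differentiable_segalBargmann1 hν hf
  refine ⟨hd, hd.continuous.aestronglyMeasurable, ?_⟩
  rw [eLpNorm_segalBargmann1 hν hf]
  exact hf.2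

end OneVariableNorm

/-! ### The Gaussian mean value property. -/

section MeanValue

variable {ν : ℝ}

/-- The mean value property of entire functions for the Gaussian measure on `ℂ`. -/
theorem integral_mul_gaussian_of_differentiable (hν : 0 < ν) {K : ℂ → ℂ} (hK : Differentiable ℂ K)
    (hi : Integrable fun η : ℂ => K η * (Real.exp (-ν * ‖η‖ ^ 2) : ℂ)) :
    ∫ η : ℂ, K η * (Real.exp (-ν * ‖η‖ ^ 2) : ℂ) = (Real.pi / ν : ℝ) * K 0 := by
  set w : ℂ → ℂ := fun η => (Real.exp (-ν * ‖η‖ ^ 2) : ℂ) with hw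
  have hwc : Continuous w := by fun_prop
  have hmp : ∀ θ : ℝ, MeasurePreserving (fun η : ℂ => (Circle.exp θ : ℂ) * η) := fun θ =>
    (rotation (Circle.exp θ)).measurePreserving
  have hme : ∀ θ : ℝ, MeasurableEmbedding (fun η : ℂ => (Circle.exp θ : ℂ) * η) := fun θ =>
    (rotation (Circle.exp θ)).toHomeomorph.measurableEmbedding
  have hwr : ∀ (θ : ℝ) (η : ℂ), w ((Circle.exp θ : ℂ) * η) = w η := by
    intro θ η
    simp [hw]
  have hrot : ∀ θ : ℝ, ∫ η : ℂ, K ((Circle.exp θ : ℂ) * η) * w η = ∫ η : ℂ, K η * w η := by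
    intro θ
    rw [← (hmp θ).integral_comp (hme θ) fun η => K η * w η]
    simp only [hwr]
  have hrotn : ∀ θ : ℝ, ∫ η : ℂ, ‖K ((Circle.exp θ : ℂ) * η) * w η‖ = ∫ η : ℂ, ‖K η * w η‖ := by
    intro θ
    rw [← (hmp θ).integral_comp (hme θ) fun η => ‖K η * w η‖]
    simp only [hwr]
  have hroti : ∀ θ : ℝ, Integrable fun η : ℂ => K ((Circle.exp θ : ℂ) * η) * w η := by
    intro θ
    have := ((hmp θ).integrable_comp_emb (hme θ)).2 hi
    refine this.congr (Filter.Eventually.of_forall fun η => ?_)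
    simp only [Function.comp_apply]
    rw [← hwr θ η]
  -- By rotation invariance the inner L¹ norm is constant in θ, hence integrable over a bounded
  -- interval.
  have hprod : Integrable (Function.uncurry fun (θ : ℝ) (η : ℂ) =>
      K ((Circle.exp θ : ℂ) * η) * w η)
      ((volume.restrict (Set.uIoc 0 (2 * Real.pi))).prod volume) := by
    have hcont : Continuous (Function.uncurry fun (θ : ℝ) (η : ℂ) =>
        K ((Circle.exp θ : ℂ) * η) * w η) := by
      have := hK.continuous
      have h2 := Circle.exp.continuous
      unfold Function.uncurry
      fun_prop
    rw [integrable_prod_iff hcont.aestronglyMeasurable]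
    refine ⟨Filter.Eventually.of_forall hroti, ?_⟩
    simp only [Function.uncurry_apply_pair, hrotn]
    exact (intervalIntegrable_const (a := 0) (b := 2 * Real.pi) (μ := volume)).def'
  -- For fixed η, the mean value property on the unit circle applies to ζ ↦ K(ζη).
  have hcircle : ∀ η : ℂ, ∫ θ in (0)..(2 * Real.pi), K ((Circle.exp θ : ℂ) * η) * w η =
      2 * Real.pi * K 0 * w η := by
    intro η
    have hmv : ∀ L : ℂ → ℂ, Differentiable ℂ L →
        ∫ θ in (0)..(2 * Real.pi), L (Circle.exp θ : ℂ) = 2 * Real.pi * L 0 := by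
      intro L hL
      have h := DiffContOnCl.circleAverage (f := L) (c := 0) (R := 1) hL.diffContOnCl
      rw [Real.circleAverage, inv_smul_eq_iff₀ (by positivity)] at h
      simpa [circleMap, Circle.coe_exp] using h
    rw [intervalIntegral.integral_mul_const]
    have h := hmv (fun ζ => K (ζ * η)) (hK.comp (differentiable_id.mul_const η))
    simp only [zero_mul] at h
    rw [h]
  have hgauss : ∫ η : ℂ, w η = (Real.pi / ν : ℝ) := by
    rw [hw, integral_complex_ofReal, GaussianFourier.integral_rexp_neg_mul_sq_norm hν,
      Complex.finrank_real_complex]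
    norm_num
  have hpi : (2 * Real.pi : ℂ) ≠ 0 := by
    simp
  have key : (2 * Real.pi : ℂ) * ∫ η : ℂ, K η * w η =
      (2 * Real.pi : ℂ) * ((Real.pi / ν : ℝ) * K 0) := by
    calc _ = ∫ θ in (0)..(2 * Real.pi), ∫ η : ℂ, K ((Circle.exp θ : ℂ) * η) * w η := by
          simp only [hrot]
          rw [intervalIntegral.integral_const]
          simp
      _ = ∫ η : ℂ, ∫ θ in (0)..(2 * Real.pi), K ((Circle.exp θ : ℂ) * η) * w η :=
          intervalIntegral_integral_swap hprod
      _ = _ := by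
          simp only [hcircle]
          rw [integral_const_mul, hgauss]
          ring
  exact mul_left_cancel₀ hpi key

end MeanValue

/-! ### B² on entire functions. -/

section Reproducing

variable {ν : ℝ}

/-- The two-dimensional transform of an entire function, by the mean value property after the
translation `ξ = (z + i w)/√2 + η`. -/
theorem segalBargmann2_eq (hν : 0 < ν) {F : ℂ → ℂ} (hF : F ∈ fockSubmodule ℂ ν)
    (p : EuclideanSpace ℂ (Fin 2)) :
    segalBargmann2 ν F p = (((ν / Real.pi) ^ (1 / 2 : ℝ) : ℝ) : ℂ) *
      F ((p 0 + Complex.I * p 1) / ((Real.sqrt 2 : ℝ) : ℂ)) := by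
  set s : ℂ := ((Real.sqrt 2 : ℝ) : ℂ)
  set b : ℂ := (p 0 + Complex.I * p 1) / s with hb
  set a : ℂ := (p 0 - Complex.I * p 1) / s with ha
  -- With η = ξ - b, the quadratic form is η(ξ̄ - a) = |η|² - η(a - b̄). The cross term is
  -- holomorphic in η and vanishes at 0, so K(0) = F(b).
  set K : ℂ → ℂ := fun η => F (b + η) * Complex.exp (ν * η * (a - star b)) with hK
  have hKd : Differentiable ℂ K := by
    have := hF.1
    rw [hK]
    fun_prop
  set C : ℂ := (((ν / Real.pi) ^ (3 / 2 : ℝ) : ℝ) : ℂ) with hC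
  have hker : ∀ x : EuclideanSpace ℝ (Fin 2), sbKernel 2 ν p x =
      C * (Complex.exp (ν * (euclideanTwoEquiv x - b) * (a - star b)) *
        (Real.exp (-ν * ‖euclideanTwoEquiv x - b‖ ^ 2) : ℂ)) := by
    intro x
    rw [Complex.ofReal_exp, ← Complex.exp_add, sbKernel, hC]
    congr 2
    · norm_num
    · have hn : ((‖euclideanTwoEquiv x - b‖ : ℝ) : ℂ) ^ 2 =
          (euclideanTwoEquiv x - b) * (star (euclideanTwoEquiv x) - star b) := by
        rw [← star_sub, Complex.star_def, Complex.mul_conj']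
      have hx : star (euclideanTwoEquiv x) = (x 0 : ℂ) - Complex.I * (x 1 : ℂ) := by
        rw [euclideanTwoEquiv_apply]
        simp [sub_eq_add_neg]
      push_cast
      rw [hn, hx, euclideanTwoEquiv_apply, Fin.sum_univ_two, hb, ha]
      linear_combination (-(ν : ℂ) * ((x 1 : ℂ) - p 1 / s) ^ 2) * Complex.I_sq
  have hint : ∀ x : EuclideanSpace ℝ (Fin 2), onR2 F x * sbKernel 2 ν p x =
      C * (K (euclideanTwoEquiv x - b) *
        (Real.exp (-ν * ‖euclideanTwoEquiv x - b‖ ^ 2) : ℂ)) := by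
    intro x
    rw [hker, onR2_eq_comp, hK]
    simp only [Function.comp_apply, add_sub_cancel]
    ring
  have hC0 : C ≠ 0 := by
    rw [hC]
    exact_mod_cast (Real.rpow_pos_of_pos (div_pos hν Real.pi_pos) _).ne'
  have hi : Integrable fun η : ℂ => K η * (Real.exp (-ν * ‖η‖ ^ 2) : ℂ) := by
    have h1 := integrable_onR2_mul_sbKernel hν hF.2 p
    simp only [hint] at h1
    rw [integrable_const_mul_iff hC0.isUnit] at h1
    have h2 := (euclideanTwoEquiv.measurePreserving.integrable_comp_emb
      euclideanTwoEquiv.toHomeomorph.measurableEmbedding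
      (g := fun ξ => K (ξ - b) * (Real.exp (-ν * ‖ξ - b‖ ^ 2) : ℂ))).1 h1
    simpa using h2.comp_add_right b
  rw [segalBargmann2, segalBargmann]
  simp only [hint]
  rw [integral_const_mul, euclideanTwoEquiv.measurePreserving.integral_comp
      euclideanTwoEquiv.toHomeomorph.measurableEmbedding
      (fun ξ => K (ξ - b) * (Real.exp (-ν * ‖ξ - b‖ ^ 2) : ℂ)),
    integral_sub_right_eq_self (fun η => K η * (Real.exp (-ν * ‖η‖ ^ 2) : ℂ)) b,
    integral_mul_gaussian_of_differentiable hν hKd hi, ← mul_assoc]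
  congr 1
  · rw [hC, ← Complex.ofReal_mul]
    congr 1
    have h0 : 0 < ν / Real.pi := div_pos hν Real.pi_pos
    have h2 : (ν / Real.pi) ^ (3 / 2 : ℝ) = (ν / Real.pi) * (ν / Real.pi) ^ (1 / 2 : ℝ) := by
      rw [← Real.rpow_one_add' h0.le (by norm_num)]
      norm_num
    rw [h2, mul_right_comm, div_mul_div_cancel₀ Real.pi_ne_zero, div_self hν.ne', one_mul]
  · simp [hK]

end Reproducing

/-- The unitary map `(z, w) ↦ ((z + i w)/√2, (z - i w)/√2)` of `ℂ²`. -/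
def nullCoordinates : EuclideanSpace ℂ (Fin 2) ≃ₗᵢ[ℝ] WithLp 2 (ℂ × ℂ) where
  toFun p := WithLp.toLp 2 ((p 0 + Complex.I * p 1) / ((Real.sqrt 2 : ℝ) : ℂ),
    (p 0 - Complex.I * p 1) / ((Real.sqrt 2 : ℝ) : ℂ))
  invFun q := !₂[(q.fst + q.snd) / ((Real.sqrt 2 : ℝ) : ℂ),
    (-Complex.I) * (q.fst - q.snd) / ((Real.sqrt 2 : ℝ) : ℂ)]
  map_add' p q := by
    refine WithLp.ofLp_injective 2 (Prod.ext ?_ ?_) <;> simp <;> ring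
  map_smul' c p := by
    refine WithLp.ofLp_injective 2 (Prod.ext ?_ ?_) <;> simp <;> ring
  left_inv p := by
    have hs := sqrt_two_cast_sq
    have hs0 := sqrt_two_cast_ne_zero
    ext j
    fin_cases j
    · simp
      field_simp
      linear_combination (-p 0) * hs
    · simp
      field_simp
      linear_combination (-2 * p 1) * Complex.I_sq - p 1 * hs
  right_inv q := by
    have hs := sqrt_two_cast_sq
    have hs0 := sqrt_two_cast_ne_zero
    refine WithLp.ofLp_injective 2 (Prod.ext ?_ ?_)
    · simp
      field_simp
      linear_combination (-(q.fst - q.snd)) * Complex.I_sq - q.fst * hs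
    · simp
      field_simp
      linear_combination (q.fst - q.snd) * Complex.I_sq - q.snd * hs
  norm_map' p := by
    -- The parallelogram law for z and iw; the division by √2 absorbs its factor 2.
    have hpar := parallelogram_law_with_norm ℝ (p 0) (Complex.I * p 1)
    rw [norm_mul, Complex.norm_I, one_mul] at hpar
    have h2 : (0 : ℝ) ≤ Real.sqrt 2 := Real.sqrt_nonneg 2
    refine (sq_eq_sq₀ (norm_nonneg _) (norm_nonneg _)).1 ?_
    rw [WithLp.prod_norm_sq_eq_of_L2, EuclideanSpace.norm_sq_eq, Fin.sum_univ_two]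
    change ‖(p 0 + Complex.I * p 1) / ((Real.sqrt 2 : ℝ) : ℂ)‖ ^ 2 +
      ‖(p 0 - Complex.I * p 1) / ((Real.sqrt 2 : ℝ) : ℂ)‖ ^ 2 = _
    simp only [norm_div, Complex.norm_real, Real.norm_of_nonneg h2, div_pow,
      Real.sq_sqrt zero_le_two]
    linarith

theorem nullCoordinates_fst (p : EuclideanSpace ℂ (Fin 2)) :
    (nullCoordinates p).fst = (p 0 + Complex.I * p 1) / ((Real.sqrt 2 : ℝ) : ℂ) :=
  rfl

/-! ### G as an isometry into the Fock space on ℂ². -/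

section TwoVariables

variable {ν : ℝ}

theorem gTransform_eq (f : ℝ → ℂ) (p : EuclideanSpace ℂ (Fin 2)) :
    gTransform ν f p = (((ν / Real.pi) ^ (1 / 2 : ℝ) : ℝ) : ℂ) *
      segalBargmann1 ν f (nullCoordinates p).fst :=
  rfl

/-- The weight factorises in the unitary coordinates; π/ν is the total Gaussian mass of the unused
one. -/
theorem lintegral_comp_nullCoordinates_fst (hν : 0 < ν) {F : ℂ → ℂ} (hF : Continuous F) :
    ∫⁻ p, ‖F (nullCoordinates p).fst‖ₑ ^ 2 ∂gaussWeight (EuclideanSpace ℂ (Fin 2)) ν =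
      ENNReal.ofReal (Real.pi / ν) * ∫⁻ ξ, ‖F ξ‖ₑ ^ 2 ∂gaussWeight ℂ ν := by
  have hm : Measurable fun ξ : ℂ => ‖F ξ‖ₑ ^ 2 := hF.enorm.measurable.pow_const 2
  have hm1 : Measurable fun ξ : ℂ => ENNReal.ofReal (Real.exp (-ν * ‖ξ‖ ^ 2)) :=
    measurable_gaussDensity
  rw [(nullCoordinates.measurePreserving_gaussWeight ν).lintegral_comp_emb
      nullCoordinates.toHomeomorph.measurableEmbedding (fun q => ‖F q.fst‖ₑ ^ 2),
    lintegral_gaussWeight_sq (f := fun q : WithLp 2 (ℂ × ℂ) => F q.fst)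
      (Continuous.aestronglyMeasurable (by fun_prop)),
    lintegral_gaussWeight_sq hF.aestronglyMeasurable,
    ← (WithLp.volume_preserving_toLp ℂ ℂ).lintegral_comp_emb
      (MeasurableEquiv.toLp 2 (ℂ × ℂ)).measurableEmbedding, Measure.volume_eq_prod]
  have hfac : ∀ q : ℂ × ℂ, ENNReal.ofReal (Real.exp (-ν * ‖WithLp.toLp 2 q‖ ^ 2)) *
      ‖F (WithLp.toLp 2 q).fst‖ₑ ^ 2 =
      (ENNReal.ofReal (Real.exp (-ν * ‖q.1‖ ^ 2)) * ‖F q.1‖ₑ ^ 2) *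
        ENNReal.ofReal (Real.exp (-ν * ‖q.2‖ ^ 2)) := by
    intro q
    rw [WithLp.prod_norm_sq_eq_of_L2, mul_add, Real.exp_add,
      ENNReal.ofReal_mul (Real.exp_pos _).le, mul_right_comm]
    rfl
  simp only [hfac]
  rw [lintegral_prod_mul (f := fun ξ : ℂ => ENNReal.ofReal (Real.exp (-ν * ‖ξ‖ ^ 2)) * ‖F ξ‖ₑ ^ 2)
    (hm1.mul hm).aemeasurable hm1.aemeasurable,
    lintegral_exp_neg_mul_norm_sq hν, Complex.finrank_real_complex, mul_comm]
  norm_num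

theorem eLpNorm_gTransform (hν : 0 < ν) {f : ℝ → ℂ} (hf : MemLp f 2 (gaussWeight ℝ ν)) :
    eLpNorm (gTransform ν f) 2 (gaussWeight _ ν) = eLpNorm f 2 (gaussWeight ℝ ν) := by
  have h0 : 0 < ν / Real.pi := div_pos hν Real.pi_pos
  apply eLpNorm_two_eq_of_sq_eq
  simp only [gTransform_eq, enorm_mul, mul_pow]
  rw [lintegral_const_mul' _ _ (ENNReal.pow_ne_top enorm_ne_top),
    lintegral_comp_nullCoordinates_fst hν (differentiable_segalBargmann1 hν hf).continuous,
    lintegral_segalBargmann1_sq hν hf, ← mul_assoc, ← ofReal_norm, Complex.norm_real,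
    Real.norm_of_nonneg (Real.rpow_nonneg h0.le _), ← ENNReal.ofReal_pow (Real.rpow_nonneg h0.le _),
    ← Real.rpow_mul_natCast h0.le, ← ENNReal.ofReal_mul (Real.rpow_nonneg h0.le _)]
  have h1 : (ν / Real.pi) ^ ((1 / 2 : ℝ) * (2 : ℕ)) * (Real.pi / ν) = 1 := by
    norm_num
    field_simp [hν.ne', Real.pi_ne_zero]
  rw [h1, ENNReal.ofReal_one, one_mul]

theorem gTransform_mem_fockSubmodule (hν : 0 < ν) {f : ℝ → ℂ}
    (hf : MemLp f 2 (gaussWeight ℝ ν)) :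
    gTransform ν f ∈ fockSubmodule (EuclideanSpace ℂ (Fin 2)) ν := by
  have hd : Differentiable ℂ (gTransform ν f) := by
    have h1 := differentiable_segalBargmann1 hν hf
    have h2 : Differentiable ℂ fun p : EuclideanSpace ℂ (Fin 2) =>
        (p 0 + Complex.I * p 1) / ((Real.sqrt 2 : ℝ) : ℂ) := by fun_prop
    exact (h1.comp h2).const_mul _
  refine ⟨hd, hd.continuous.aestronglyMeasurable, ?_⟩
  rw [eLpNorm_gTransform hν hf]
  exact hf.2

/-- Needed for linearity on `Lp`, where representatives of sums and multiples agree only almost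
everywhere. -/
theorem segalBargmann1_congr_ae {f g : ℝ → ℂ} (h : f =ᵐ[gaussWeight ℝ ν] g) :
    segalBargmann1 ν f = segalBargmann1 ν g := by
  ext ξ
  rw [segalBargmann1_eq, segalBargmann1_eq]
  congr 1
  refine integral_congr_ae ((absolutelyContinuous_gaussWeight.ae_eq h).mono fun x hx => ?_)
  simp only [hx]

theorem segalBargmann1_add (hν : 0 < ν) {f g : ℝ → ℂ} (hf : MemLp f 2 (gaussWeight ℝ ν))
    (hg : MemLp g 2 (gaussWeight ℝ ν)) :
    segalBargmann1 ν (f + g) = segalBargmann1 ν f + segalBargmann1 ν g := by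
  ext ξ
  simp only [Pi.add_apply, segalBargmann1_eq, add_mul]
  rw [integral_add (integrable_mul_sbExp hν hf ξ) (integrable_mul_sbExp hν hg ξ), mul_add]

theorem segalBargmann1_smul (c : ℂ) (f : ℝ → ℂ) :
    segalBargmann1 ν (c • f) = c • segalBargmann1 ν f := by
  ext ξ
  simp only [Pi.smul_apply, segalBargmann1_eq, smul_eq_mul, mul_assoc]
  rw [integral_const_mul, mul_left_comm]

/-- The transform `G^ν` as a linear isometry. -/
def gTransformₗᵢ (hν : 0 < ν) :
    Lp ℂ 2 (gaussWeight ℝ ν) →ₗᵢ[ℂ] BargmannFock (EuclideanSpace ℂ (Fin 2)) ν where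
  toFun f := ⟨gTransform ν f, gTransform_mem_fockSubmodule hν (Lp.memLp f)⟩
  map_add' f g := by
    refine Subtype.ext (funext fun p => ?_)
    change gTransform ν _ p = gTransform ν f p + gTransform ν g p
    rw [gTransform_eq, gTransform_eq, gTransform_eq, segalBargmann1_congr_ae (Lp.coeFn_add f g),
      segalBargmann1_add hν (Lp.memLp f) (Lp.memLp g), Pi.add_apply, mul_add]
  map_smul' c f := by
    refine Subtype.ext (funext fun p => ?_)
    change gTransform ν _ p = c * gTransform ν f p
    rw [gTransform_eq, gTransform_eq, segalBargmann1_congr_ae (Lp.coeFn_smul c f),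
      segalBargmann1_smul, Pi.smul_apply, smul_eq_mul, mul_left_comm]
  norm_map' f := by
    change ‖(gTransform_mem_fockSubmodule hν (Lp.memLp f)).2.toLp (gTransform ν f)‖ = ‖f‖
    rw [Lp.norm_toLp, eLpNorm_gTransform hν (Lp.memLp f), Lp.norm_def]

end TwoVariables

end

theorem mainTheorem1 (ν : ℝ) (hν : 0 < ν) :
    (∀ f : ℝ → ℂ, MemLp f 2 (gaussWeight ℝ ν) →
      (∀ ξ : ℂ, Integrable fun x => onR1 f x * sbKernel 1 ν (!₂[ξ]) x) ∧
      segalBargmann1 ν f ∈ fockSubmodule ℂ ν ∧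
      (∀ p : EuclideanSpace ℂ (Fin 2),
        Integrable fun x => onR2 (segalBargmann1 ν f) x * sbKernel 2 ν p x) ∧
      gTransform ν f = segalBargmann2 ν (segalBargmann1 ν f)) ∧
    ∃ U : Lp ℂ 2 (gaussWeight ℝ ν) →ₗᵢ[ℂ] BargmannFock (EuclideanSpace ℂ (Fin 2)) ν,
      ∀ (f : Lp ℂ 2 (gaussWeight ℝ ν)) (p : EuclideanSpace ℂ (Fin 2)),
        U f p = gTransform ν f p := by
  refine ⟨fun f hf => ?_, gTransformₗᵢ hν, fun f p => rfl⟩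
  have hB := segalBargmann1_mem_fockSubmodule hν hf
  exact ⟨fun ξ => integrable_onR1_mul_sbKernel hν hf _, hB,
    fun p => integrable_onR2_mul_sbKernel hν hB.2 p,
    funext fun p => (segalBargmann2_eq hν hB p).symm⟩
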